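/- Let $G=\mathrm{Aff}_+(\mathbb R)=\{(x,y)\in\mathbb R^2 : y>0\}$ with the product $(x_2,y_2)\cdot(x_1,y_1)=(x_2+y_2x_1,\,y_2y_1)$, identity $\mathrm{Id}=(0,1)$, and left-invariant frame $X_1=y\,\partial_x$, $X_2=y\,\partial_y$. Let $A=\begin{pmatrix}a&b\\c&d\end{pmatrix}$ be a real matrix with $\det A>0$ and $a\ge 0$, and put $A^{-1}=\begin{pmatrix}\alpha&\beta\\\gamma&\delta\end{pmatrix}$. Consider the left-invariant Lorentzian metric on $G$ with $$g(u_1X_1+u_2X_2)=-(au_1+bu_2)^2+(cu_1+du_2)^2,$$ time-oriented by a left-invariant timelike vector field $X_0$ whose coordinates $(u_1,u_2)$ in the frame $X_1,X_2$ satisfy $au_1+bu_2>0$. A Lipschitz curve $q:[0,t_1]\to G$, $t_1\ge 0$, is future directed nonspacelike if $g(\dot q,\dot q)\le 0$ and $g(\dot q,X_0)<0$ almost everywhere; its length is $\int_0^{t_1}|g(\dot q,\dot q)|^{1/2}dt$. Let $J^+$ be the set of points that can be reached from $\mathrm{Id}$ by such curves. Let $d(q_1)\in[0,+\infty]$ be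 the supremum of the lengths of such curves from $\mathrm{Id}$ to $q_1$, with $d(q_1)=0$ if there are none. Set $\lambda_1(x,y)=(c-a)x+(d-b)(y-1)$, $\lambda_2(x,y)=(c+a)x+(d+b)(y-1)$, $B=\left(\frac{d+b}{c+a},0\right)$, $\lambda_3=\lambda_1-\lambda_1(B)$, and $$D=\{q\in G:\lambda_1(q)\le 0\le\lambda_2(q),\ \lambda_3(q)>0\},\quad F=\{q\in G:\lambda_3(q)=0\},\quad E=\{q\in G:\lambda_3(q)<0\}.$$ Set also $\Delta=\sqrt{\delta^2-\gamma^2}$, $\lambda=\frac{\alpha\delta-\beta\gamma}{\Delta^2}$, $\nu=\frac{\beta\delta-\alpha\gamma}{\Delta^2}$. The sectional curvature of $g$ is a constant $K$. Suppose $K<0$. Then $\Delta$ is well defined and positive, $\lambda\neq 0$, and for every $q_1=(x_1,y_1)\in G$: 1. If $q_1\notin J^+$, then $d(q_1)=0$. 2. If $q_1\in\partial J^+$ (boundary in $G$), then $d(q_1)=0$. 3. If $q_1\in\operatorname{int}D$, then $d(q_1)=\dfrac{\tau-\rho}{\Delta}$, where $$\tau=\arcsin\frac{y_1^2+w^2-1}{2y_1w},\qquad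 \rho=\arcsin\frac{y_1^2-w^2-1}{2w},\qquad w=\frac{x_1-\nu(y_1-1)}{\lambda};$$ here $w\ne 0$ and both arguments of $\arcsin$ lie in $(-1,1)$. In particular, $d(\operatorname{int}D)=\left(0,\frac{\pi}{\Delta}\right)$. 4. If $q_1\in F$, then $d(q_1)=\dfrac{\pi}{\Delta}$. 5. If $q_1\in E$, then $d(q_1)=+\infty$. -/

import Mathlib

open Set MeasureTheory
open scoped ENNReal

noncomputable section

/-- The group `Aff₊(ℝ)` of proper affine maps `s ↦ y * s + x` of the line, as the upper half-plane
of pairs `(x, y)` with `y > 0`. It carries the subspace topology of `ℝ × ℝ`. -/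
abbrev AffPlus : Type := {p : ℝ × ℝ // 0 < p.2}

namespace AffPlus

/-- Composition of affine maps: `(x₂, y₂) * (x₁, y₁) = (x₂ + y₂ x₁, y₂ y₁)`. -/
instance : Mul AffPlus :=
  ⟨fun p q => ⟨(p.1.1 + p.1.2 * q.1.1, p.1.2 * q.1.2), mul_pos p.2 q.2⟩⟩

instance : One AffPlus := ⟨⟨(0, 1), one_pos⟩⟩

instance : Inv AffPlus := ⟨fun p => ⟨(-(p.1.1 / p.1.2), p.1.2⁻¹), inv_pos.2 p.2⟩⟩

theorem coe_mul (p q : AffPlus) :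
    (p * q).1 = (p.1.1 + p.1.2 * q.1.1, p.1.2 * q.1.2) := rfl

theorem coe_one : (1 : AffPlus).1 = (0, 1) := rfl

theorem coe_inv (p : AffPlus) : (p⁻¹).1 = (-(p.1.1 / p.1.2), p.1.2⁻¹) := rfl

instance : Group AffPlus :=
  Group.ofLeftAxioms
    (by
      intro p q r
      apply Subtype.ext
      simp only [coe_mul, Prod.mk.injEq]
      constructor <;> ring)
    (by
      intro p
      apply Subtype.ext
      simp [coe_mul, coe_one])
    (by
      intro p
      have hp : p.1.2 ≠ 0 := p.2.ne'
      apply Subtype.ext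
      simp only [coe_mul, coe_inv, coe_one, Prod.mk.injEq]
      constructor
      · field_simp
        ring
      · field_simp)

/-- The value at `q = (x, y)` of the left-invariant vector field `u₁ X₁ + u₂ X₂`, where
`X₁ = y ∂/∂x` and `X₂ = y ∂/∂y`. -/
def leftField (u q : ℝ × ℝ) : ℝ × ℝ := (q.2 * u.1, q.2 * u.2)

/-- `leftField u q` is the image of `u` under the differential at the identity of the left
translation by `q`. -/
theorem hasFDerivAt_leftTranslation (q : AffPlus) :
    ∃ L : ℝ × ℝ →L[ℝ] ℝ × ℝ,
      HasFDerivAt (fun p : ℝ × ℝ => (q.1.1 + q.1.2 * p.1, q.1.2 * p.2)) L (1 : AffPlus).1 ∧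
      ∀ u, L u = leftField u q.1 := by
  refine ⟨(q.1.2 • ContinuousLinearMap.fst ℝ ℝ ℝ).prod
    (q.1.2 • ContinuousLinearMap.snd ℝ ℝ ℝ), ?_, fun u => by simp [leftField]⟩
  exact ((hasFDerivAt_fst.const_mul q.1.2).const_add q.1.1).prodMk
    (hasFDerivAt_snd.const_mul q.1.2)

/-- The linear form `v₁ = a u₁ + b u₂`. -/
def v₁ (A : Matrix (Fin 2) (Fin 2) ℝ) (u : ℝ × ℝ) : ℝ := A 0 0 * u.1 + A 0 1 * u.2

/-- The linear form `v₂ = c u₁ + d u₂`. -/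
def v₂ (A : Matrix (Fin 2) (Fin 2) ℝ) (u : ℝ × ℝ) : ℝ := A 1 0 * u.1 + A 1 1 * u.2

/-- The symmetric bilinear form on the Lie algebra (in the basis `X₁, X₂`) whose quadratic form is
`g(u) = -(a u₁ + b u₂)² + (c u₁ + d u₂)²`, for `A = !![a, b; c, d]`. -/
def lieForm (A : Matrix (Fin 2) (Fin 2) ℝ) (u w : ℝ × ℝ) : ℝ :=
  -(v₁ A u * v₁ A w) + v₂ A u * v₂ A w

/-- The left-invariant Lorentzian metric on the group determined by `lieForm A`, evaluated on
coordinate tangent vectors `ξ, η` at `q = (x, y)`, `y > 0`: the vector `ξ` is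
`(ξ₁ / y) X₁ + (ξ₂ / y) X₂`. -/
def metric (A : Matrix (Fin 2) (Fin 2) ℝ) (q ξ η : ℝ × ℝ) : ℝ :=
  lieForm A (ξ.1 / q.2, ξ.2 / q.2) (η.1 / q.2, η.2 / q.2)

/-! ### Sectional curvature, in the global chart `(x, y)` -/

/-- The coordinate vectors `∂/∂x` and `∂/∂y`. -/
def coordVec (i : Fin 2) : ℝ × ℝ := if i = 0 then (1, 0) else (0, 1)

/-- Matrix of the metric in the coordinates `(x, y)`. -/
def metricMatrix (A : Matrix (Fin 2) (Fin 2) ℝ) (q : ℝ × ℝ) : Matrix (Fin 2) (Fin 2) ℝ :=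
  Matrix.of fun i j => metric A q (coordVec i) (coordVec j)

/-- Partial derivative of `f` in the `i`-th coordinate. -/
def pderiv (i : Fin 2) (f : ℝ × ℝ → ℝ) (q : ℝ × ℝ) : ℝ := lineDeriv ℝ f q (coordVec i)

/-- Christoffel symbols `Γᵏᵢⱼ` of the Levi-Civita connection of a field `h` of nondegenerate
symmetric matrices. -/
def christoffel (h : ℝ × ℝ → Matrix (Fin 2) (Fin 2) ℝ) (k i j : Fin 2) (q : ℝ × ℝ) : ℝ :=
  1 / 2 * ∑ l, (h q)⁻¹ k l *
    (pderiv i (fun p => h p j l) q + pderiv j (fun p => h p i l) q - pderiv l (fun p => h p i j) q)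

/-- The `l`-th component of `∇ᵢ ∇ⱼ ∂ₖ - ∇ⱼ ∇ᵢ ∂ₖ`. -/
def riemann (h : ℝ × ℝ → Matrix (Fin 2) (Fin 2) ℝ) (l k i j : Fin 2) (q : ℝ × ℝ) : ℝ :=
  pderiv i (christoffel h l j k) q - pderiv j (christoffel h l i k) q +
    ∑ m, (christoffel h l i m q * christoffel h m j k q -
      christoffel h l j m q * christoffel h m i k q)

/-- The sectional curvature, at `q`, of the (unique) tangent plane:
`g(R(∂ₓ, ∂ᵧ) ∂ᵧ, ∂ₓ) / (g(∂ₓ, ∂ₓ) g(∂ᵧ, ∂ᵧ) - g(∂ₓ, ∂ᵧ)²)`. -/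
def sectionalCurvature (A : Matrix (Fin 2) (Fin 2) ℝ) (q : AffPlus) : ℝ :=
  (∑ l, riemann (metricMatrix A) l 1 0 1 q.1 * metricMatrix A q.1 l 0) / (metricMatrix A q.1).det

/-! ### Causal curves, Lorentzian length, Lorentzian distance -/

/-- `γ : [0, T] → G` is a Lipschitz future directed nonspacelike curve from `p` to `q`, for the
time orientation given by the left-invariant field `X₀`. -/
structure IsCausalCurve (A : Matrix (Fin 2) (Fin 2) ℝ) (X₀ : ℝ × ℝ) (p q : AffPlus)
    (T : ℝ) (γ : ℝ → ℝ × ℝ) : Prop where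
  nonneg : 0 ≤ T
  lipschitz : ∃ C, LipschitzOnWith C γ (Icc 0 T)
  mem : ∀ t ∈ Icc 0 T, 0 < (γ t).2
  source : γ 0 = p.1
  target : γ T = q.1
  nonspacelike : ∀ᵐ t ∂volume.restrict (Icc 0 T), metric A (γ t) (deriv γ t) (deriv γ t) ≤ 0
  future : ∀ᵐ t ∂volume.restrict (Icc 0 T),
    metric A (γ t) (deriv γ t) (leftField X₀ (γ t)) < 0

/-- Lorentzian length `∫₀ᵀ |g(γ', γ')|^(1/2) dt`. -/
def length (A : Matrix (Fin 2) (Fin 2) ℝ) (T : ℝ) (γ : ℝ → ℝ × ℝ) : ℝ≥0∞ :=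
  ∫⁻ t in Icc 0 T, ENNReal.ofReal (Real.sqrt |metric A (γ t) (deriv γ t) (deriv γ t)|)

/-- Causal future `J⁺(p)`. -/
def causalFuture (A : Matrix (Fin 2) (Fin 2) ℝ) (X₀ : ℝ × ℝ) (p : AffPlus) : Set AffPlus :=
  {q | ∃ T γ, IsCausalCurve A X₀ p q T γ}

/-- Lorentzian distance: the supremum of the lengths of the future directed nonspacelike curves
from `p` to `q`. It is `0` if there are none, as the supremum of the empty set in `[0, ∞]`. -/
def lorentzDist (A : Matrix (Fin 2) (Fin 2) ℝ) (X₀ : ℝ × ℝ) (p q : AffPlus) : ℝ≥0∞ :=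
  ⨆ (T : ℝ) (γ : ℝ → ℝ × ℝ) (_ : IsCausalCurve A X₀ p q T γ), length A T γ

/-! ### The sets `D`, `F`, `E` -/

/-- `λ₁(x, y) = (c - a) x + (d - b) (y - 1)`. -/
def lam₁ (A : Matrix (Fin 2) (Fin 2) ℝ) (q : ℝ × ℝ) : ℝ :=
  (A 1 0 - A 0 0) * q.1 + (A 1 1 - A 0 1) * (q.2 - 1)

/-- `λ₂(x, y) = (c + a) x + (d + b) (y - 1)`. -/
def lam₂ (A : Matrix (Fin 2) (Fin 2) ℝ) (q : ℝ × ℝ) : ℝ :=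
  (A 1 0 + A 0 0) * q.1 + (A 1 1 + A 0 1) * (q.2 - 1)

/-- The point `B = ((d + b) / (c + a), 0)` of the boundary line `y = 0`. -/
def pointB (A : Matrix (Fin 2) (Fin 2) ℝ) : ℝ × ℝ :=
  ((A 1 1 + A 0 1) / (A 1 0 + A 0 0), 0)

/-- `λ₃(q) = λ₁(q) - λ₁(B)`. -/
def lam₃ (A : Matrix (Fin 2) (Fin 2) ℝ) (q : ℝ × ℝ) : ℝ := lam₁ A q - lam₁ A (pointB A)

def setD (A : Matrix (Fin 2) (Fin 2) ℝ) : Set AffPlus :=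
  {q | lam₁ A q.1 ≤ 0 ∧ 0 ≤ lam₂ A q.1 ∧ 0 < lam₃ A q.1}

def setF (A : Matrix (Fin 2) (Fin 2) ℝ) : Set AffPlus := {q | lam₃ A q.1 = 0}

def setE (A : Matrix (Fin 2) (Fin 2) ℝ) : Set AffPlus := {q | lam₃ A q.1 < 0}

/-! ### The explicit formulas, with `A⁻¹ = !![α, β; γ, δ]` -/

/-- `Δ = √(δ² - γ²)`. -/
def Delta (A : Matrix (Fin 2) (Fin 2) ℝ) : ℝ := Real.sqrt (A⁻¹ 1 1 ^ 2 - A⁻¹ 1 0 ^ 2)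

/-- `λ = (α δ - β γ) / Δ²`. -/
def lam (A : Matrix (Fin 2) (Fin 2) ℝ) : ℝ :=
  (A⁻¹ 0 0 * A⁻¹ 1 1 - A⁻¹ 0 1 * A⁻¹ 1 0) / Delta A ^ 2

/-- `ν = (β δ - α γ) / Δ²`. -/
def nu (A : Matrix (Fin 2) (Fin 2) ℝ) : ℝ :=
  (A⁻¹ 0 1 * A⁻¹ 1 1 - A⁻¹ 0 0 * A⁻¹ 1 0) / Delta A ^ 2

/-- `w = (x - ν (y - 1)) / λ`. -/
def wCoord (A : Matrix (Fin 2) (Fin 2) ℝ) (q : ℝ × ℝ) : ℝ := (q.1 - nu A * (q.2 - 1)) / lam A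

/-- `sin τ = (y² + w² - 1) / (2 y w)`. -/
def sinTau (A : Matrix (Fin 2) (Fin 2) ℝ) (q : ℝ × ℝ) : ℝ :=
  (q.2 ^ 2 + wCoord A q ^ 2 - 1) / (2 * q.2 * wCoord A q)

/-- `sin ρ = (y² - w² - 1) / (2 w)`. -/
def sinRho (A : Matrix (Fin 2) (Fin 2) ℝ) (q : ℝ × ℝ) : ℝ :=
  (q.2 ^ 2 - wCoord A q ^ 2 - 1) / (2 * wCoord A q)

/-- `τ = arcsin ((y² + w² - 1) / (2 y w))`. -/
def tau (A : Matrix (Fin 2) (Fin 2) ℝ) (q : ℝ × ℝ) : ℝ := Real.arcsin (sinTau A q)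

/-- `ρ = arcsin ((y² - w² - 1) / (2 w))`. -/
def rho (A : Matrix (Fin 2) (Fin 2) ℝ) (q : ℝ × ℝ) : ℝ := Real.arcsin (sinRho A q)

end AffPlus

end

namespace AffPlus

variable {A : Matrix (Fin 2) (Fin 2) ℝ}

/-! The curvature is `K = (c² - a²) / (det A)²`, the same at every point, so `K < 0` and `a ≥ 0`
mean `|c| < a`. Completing the square in `u₁` then gives global coordinates `(w, y)`, `y > 0`, in
which the metric is `(dy² - dw²) / (Δ² y²)`, conformal to a Minkowski half-plane. Future directed
nonspacelike means `|dy| ≤ dw`, `dw > 0`; the identity is `(0, 1)`; and `D`, `F`, `E` are cut out by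
comparing `w` with `|y - 1|` and `y + 1`.

Upper bounds come from a calibration. For fixed `w₀` put `h = (w - w₀) / y`. Along a causal curve
with `|h| ≤ 1` the function `arcsin h / Δ` grows at least as fast as arc length, with equality where
`dy = h dw`, that is, along the hyperbolas `y² - (w - w₀)² = const`, the timelike geodesics. Since
`w ± y` are nondecreasing, a causal curve with both endpoints in `|w - w₀| ≤ y` stays there, so
`IsCausalCurve.length_le` needs a condition on the endpoints only.

Lower bounds come from graphs `y = f(w)` of positive 1-Lipschitz functions. In the interior of `D`,
the hyperbola through the identity and `q₁` has centre `w₀ = -sin ρ`; it attains the calibration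
bound `(τ - ρ) / Δ`. On the boundary of `J⁺` the choice `w₀ = ±1` makes the bound zero. On `F`, `w₀
= 1` gives the bound `π / Δ`, approached by hyperbolas completed by a horizontal segment. On `E`, a
curve can descend along a null line to height `ε`, run horizontally and return along a null line;
its length blows up as `ε → 0`. -/

/-! ### Curvature of the metric -/

theorem sq_lt_sq_entry_of_sectionalCurvature_neg {A : Matrix (Fin 2) (Fin 2) ℝ} (hdet : 0 < A.det)
    {p : AffPlus} (hK : sectionalCurvature A p < 0) : A 1 0 ^ 2 < A 0 0 ^ 2 := by
  set G : Matrix (Fin 2) (Fin 2) ℝ :=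
    Matrix.of fun i j => lieForm A (coordVec i) (coordVec j) with hG
  -- In the chart the metric is `y⁻²` times a constant Gram matrix, so the Christoffel symbols are
  -- constants divided by `y` and the curvature becomes an algebraic expression in the entries of
  -- `G`.
  have hh : metricMatrix A = fun q => (q.2 ^ 2)⁻¹ • G := by
    funext q
    ext i j
    simp only [metricMatrix, metric, hG, Matrix.of_apply, Matrix.smul_apply, smul_eq_mul, lieForm,
      v₁, v₂]
    simp only [div_eq_mul_inv]
    ring
  have hGdet : G.det = -A.det ^ 2 := by
    simp [hG, Matrix.det_fin_two, lieForm, v₁, v₂, coordVec]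
    ring
  have hG0 : G.det ≠ 0 := by rw [hGdet]; have := pow_pos hdet 2; linarith
  have hsymm : G 1 0 = G 0 1 := by simp [hG, lieForm, v₁, v₂]; ring
  have hp0 (f : ℝ → ℝ) (q : ℝ × ℝ) : pderiv 0 (fun r => f r.2) q = 0 := by
    simp [pderiv, lineDeriv, coordVec]
  have hp1 (f : ℝ → ℝ) (q : ℝ × ℝ) : pderiv 1 (fun r => f r.2) q = deriv f q.2 := by
    simp only [pderiv, lineDeriv, coordVec]
    simp only [one_ne_zero, if_false, Prod.snd_add, Prod.smul_snd, smul_eq_mul, mul_one]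
    rw [deriv_comp_const_add (f := f)]; simp
  have hd2 (y : ℝ) (hy : 0 < y) (c : ℝ) :
      deriv (fun y : ℝ => (y ^ 2)⁻¹ * c) y = -2 * c / y ^ 3 := by
    have := (((hasDerivAt_pow 2 y).inv (by positivity)).mul_const c).deriv
    simp only [Pi.inv_apply] at this
    rw [this]
    field_simp
    push_cast
    ring
  have hd1 (y : ℝ) (hy : 0 < y) (c : ℝ) : deriv (fun y : ℝ => c / y) y = -c / y ^ 2 := by
    have := ((hasDerivAt_inv hy.ne').const_mul c).deriv
    simp only [div_eq_mul_inv]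
    rw [this]; ring
  let C (k i j : Fin 2) : ℝ := -∑ l, G⁻¹ k l *
    ((if i = 1 then G j l else 0) + (if j = 1 then G i l else 0) - (if l = 1 then G i j else 0))
  have hp (i j l : Fin 2) (q : ℝ × ℝ) (hq : 0 < q.2) :
      pderiv i (fun p => metricMatrix A p j l) q = (if i = 1 then -2 * G j l / q.2 ^ 3 else 0) := by
    rw [hh]
    simp only [Matrix.smul_apply, smul_eq_mul]
    fin_cases i
    · simpa using hp0 (fun y => (y ^ 2)⁻¹ * G j l) q
    · exact ((hp1 (fun y => (y ^ 2)⁻¹ * G j l) q).trans (hd2 q.2 hq _)).trans (by simp)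
  have hC (k i j : Fin 2) (q : ℝ × ℝ) (hq : 0 < q.2) :
      christoffel (metricMatrix A) k i j q = C k i j / q.2 := by
    have hinv : (metricMatrix A q)⁻¹ = q.2 ^ 2 • G⁻¹ := by
      rw [hh]
      have h2 : (q.2 ^ 2)⁻¹ ≠ 0 := by positivity
      refine Matrix.inv_eq_left_inv ?_
      rw [Matrix.smul_mul, Matrix.mul_smul, smul_smul, Matrix.nonsing_inv_mul _ hG0.isUnit,
        mul_inv_cancel₀ (by positivity), one_smul]
    simp only [christoffel, C, hp _ _ _ q hq, hinv, Matrix.smul_apply, smul_eq_mul]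
    rw [Finset.mul_sum, ← Finset.sum_neg_distrib, Finset.sum_div]
    refine Finset.sum_congr rfl fun l _ => ?_
    split_ifs <;> field_simp <;> ring
  have hCd (m k i j : Fin 2) (q : ℝ × ℝ) (hq : 0 < q.2) :
      pderiv m (christoffel (metricMatrix A) k i j) q =
        if m = 1 then -C k i j / q.2 ^ 2 else 0 := by
    have : pderiv m (christoffel (metricMatrix A) k i j) q =
        pderiv m (fun r => C k i j / r.2) q := by
      refine Filter.EventuallyEq.lineDeriv_eq ?_
      filter_upwards [(isOpen_lt continuous_const continuous_snd).mem_nhds hq] with r hr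
      exact hC k i j r hr
    rw [this]
    fin_cases m
    · simpa using hp0 (fun y => C k i j / y) q
    · simpa [hd1 q.2 hq] using hp1 (fun y => C k i j / y) q
  have hK' : sectionalCurvature A p = (A 1 0 ^ 2 - A 0 0 ^ 2) / A.det ^ 2 := by
    have hy := p.2
    have hGinv : G⁻¹ = (G.det)⁻¹ • !![G 1 1, -G 0 1; -G 1 0, G 0 0] := by
      rw [Matrix.inv_def, Matrix.adjugate_fin_two, Ring.inverse_eq_inv']
    have hdetm : (metricMatrix A p.1).det = ((p.1.2 ^ 2)⁻¹) ^ 2 * G.det := by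
      rw [hh]; simp
    have hG00 : A 1 0 ^ 2 - A 0 0 ^ 2 = G 0 0 := by
      simp [hG, lieForm, v₁, v₂, coordVec]; ring
    have hmm (i j) : metricMatrix A p.1 i j = (p.1.2 ^ 2)⁻¹ * G i j := by rw [hh]; simp
    have hD := Matrix.det_fin_two G
    have hA2 : A.det ^ 2 = - G.det := by rw [hGdet]; ring
    rw [sectionalCurvature, hdetm, hA2, hG00]
    simp only [riemann, hCd _ _ _ _ _ hy, hC _ _ _ _ hy, hmm, Fin.sum_univ_two, C, hGinv]
    simp only [Matrix.smul_apply, smul_eq_mul, Matrix.cons_val', Matrix.of_apply,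
      Matrix.cons_val_zero, Matrix.cons_val_one, Fin.isValue, if_true, if_false, zero_ne_one, Matrix.cons_val_fin_one, hsymm]
    rw [hsymm] at hD
    generalize G.det = D at *
    generalize G 0 0 = g0 at *
    generalize G 0 1 = g1 at *
    generalize G 1 1 = g2 at *
    subst hD
    have hD0 : g0 * g2 - g1 ^ 2 ≠ 0 := by rwa [sq]
    simp only [← sq]
    field_simp
    ring
  rw [hK'] at hK
  have h2 : 0 < A.det ^ 2 := by positivity
  by_contra! hcon
  exact absurd hK (not_lt.2 (div_nonneg (by linarith) h2.le))

theorem abs_entry_lt_of_sectionalCurvature_neg (hdet : 0 < A.det) (ha : 0 ≤ A 0 0)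
    {p : AffPlus} (hK : sectionalCurvature A p < 0) : |A 1 0| < A 0 0 :=
  abs_lt_of_sq_lt_sq (sq_lt_sq_entry_of_sectionalCurvature_neg hdet hK) ha

theorem sub_sq_entry_pos (hA : |A 1 0| < A 0 0) : 0 < A 0 0 ^ 2 - A 1 0 ^ 2 := by
  have := abs_lt.1 hA
  nlinarith

/-! ### The metric and the causal cone in the coordinates `(w, y)` -/

theorem inv_entries (A : Matrix (Fin 2) (Fin 2) ℝ) :
    A⁻¹ = !![A 1 1 / A.det, -A 0 1 / A.det; -A 1 0 / A.det, A 0 0 / A.det] := by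
  rw [Matrix.inv_def, Matrix.adjugate_fin_two, Ring.inverse_eq_inv']
  ext i j
  fin_cases i <;> fin_cases j <;> simp [div_eq_inv_mul]

theorem Delta_radicand (hdet : 0 < A.det) :
    A⁻¹ 1 1 ^ 2 - A⁻¹ 1 0 ^ 2 = (A 0 0 ^ 2 - A 1 0 ^ 2) / A.det ^ 2 := by
  rw [inv_entries A]
  simp
  field_simp

theorem Delta_sq (hdet : 0 < A.det) (hA : |A 1 0| < A 0 0) :
    Delta A ^ 2 = (A 0 0 ^ 2 - A 1 0 ^ 2) / A.det ^ 2 := by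
  rw [Delta, Delta_radicand hdet, Real.sq_sqrt]
  exact div_nonneg (sub_sq_entry_pos hA).le (sq_nonneg _)

theorem Delta_pos (hdet : 0 < A.det) (hA : |A 1 0| < A 0 0) : 0 < Delta A := by
  rw [Delta, Delta_radicand hdet, Real.sqrt_pos]
  exact div_pos (sub_sq_entry_pos hA) (by positivity)

theorem lam_eq (hdet : 0 < A.det) (hA : |A 1 0| < A 0 0) :
    lam A = A.det / (A 0 0 ^ 2 - A 1 0 ^ 2) := by
  have h1 := (sub_sq_entry_pos hA).ne'
  rw [lam, Delta_sq hdet hA, inv_entries A]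
  simp
  field_simp
  rw [Matrix.det_fin_two]
  ring

theorem lam_pos (hdet : 0 < A.det) (hA : |A 1 0| < A 0 0) : 0 < lam A := by
  rw [lam_eq hdet hA]
  exact div_pos hdet (sub_sq_entry_pos hA)

theorem nu_eq (hdet : 0 < A.det) (hA : |A 1 0| < A 0 0) :
    nu A = (A 1 0 * A 1 1 - A 0 0 * A 0 1) / (A 0 0 ^ 2 - A 1 0 ^ 2) := by
  have h1 := (sub_sq_entry_pos hA).ne'
  rw [nu, Delta_sq hdet hA, inv_entries A]
  simp
  field_simp
  ring

/-- The differential of `wCoord`. -/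
noncomputable def wForm (A : Matrix (Fin 2) (Fin 2) ℝ) (ξ : ℝ × ℝ) : ℝ := (ξ.1 - nu A * ξ.2) / lam A

/-- Completing the square in `u₁`: `-v₁² + v₂² = -(a² - c²)(u₁ - ν u₂)² + (det A)² / (a² - c²) u₂²`,
and both coefficients become `1 / Δ²` in absolute value after scaling by `λ`. For `y = 0` both sides
are zero through division by zero. -/
theorem metric_eq (hdet : 0 < A.det) (hA : |A 1 0| < A 0 0) (q ξ η : ℝ × ℝ) :
    metric A q ξ η = (ξ.2 * η.2 - wForm A ξ * wForm A η) / (Delta A ^ 2 * q.2 ^ 2) := by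
  have h1 := (sub_sq_entry_pos hA).ne'
  have h2 := Matrix.det_fin_two A
  have h3 := hdet.ne'
  rw [wForm, wForm, lam_eq hdet hA, nu_eq hdet hA, Delta_sq hdet hA]
  simp only [metric, lieForm, v₁, v₂]
  rcases eq_or_ne q.2 0 with h | h
  · simp [h]
  · field_simp
    rw [h2]
    ring

theorem lieForm_eq (hdet : 0 < A.det) (hA : |A 1 0| < A 0 0) (u : ℝ × ℝ) :
    lieForm A u u = (u.2 ^ 2 - wForm A u ^ 2) / Delta A ^ 2 := by
  have := metric_eq hdet hA (0, 1) u u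
  simpa [metric, ← sq] using this

theorem v₁_eq (hdet : 0 < A.det) (hA : |A 1 0| < A 0 0) (u : ℝ × ℝ) :
    v₁ A u = A.det / (A 0 0 ^ 2 - A 1 0 ^ 2) * (A 0 0 * wForm A u + A 1 0 * u.2) := by
  have h1 := (sub_sq_entry_pos hA).ne'
  have h2 := Matrix.det_fin_two A
  have h3 := hdet.ne'
  rw [wForm, lam_eq hdet hA, nu_eq hdet hA, v₁]
  field_simp
  rw [h2]
  ring

/-- Timelike vectors satisfy `|dy| < |dw|`. As `v₁` is a positive multiple of `a dw + c dy` with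
`|c| < a`, its sign on them is that of `dw`. -/
theorem abs_lt_wForm_of_future (hdet : 0 < A.det) (hA : |A 1 0| < A 0 0) {X₀ : ℝ × ℝ}
    (hX₀ : lieForm A X₀ X₀ < 0) (hX₀A : 0 < v₁ A X₀) : |X₀.2| < wForm A X₀ := by
  have hΔ := Delta_pos hdet hA
  rw [lieForm_eq hdet hA, div_neg_iff] at hX₀
  have hsq : X₀.2 ^ 2 < wForm A X₀ ^ 2 := by
    rcases hX₀ with h | h
    · exact absurd h.2 (not_lt.2 (sq_nonneg _))
    · linarith [h.1]
  rw [v₁_eq hdet hA] at hX₀A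
  have h := pos_of_mul_pos_right hX₀A (div_pos hdet (sub_sq_entry_pos hA)).le
  have hlt := sq_lt_sq.1 hsq
  rcases lt_or_ge 0 (wForm A X₀) with hw | hw
  · rwa [abs_of_pos hw] at hlt
  · rw [abs_of_nonpos hw] at hlt
    have h1 : A 1 0 * X₀.2 ≤ |A 1 0| * |X₀.2| := by rw [← abs_mul]; exact le_abs_self _
    nlinarith [abs_nonneg X₀.2, abs_nonneg (A 1 0)]

/-- A vector is nonspacelike and future directed iff `|dy| ≤ dw` and `dw > 0`. -/
theorem metric_causal_iff (hdet : 0 < A.det) (hA : |A 1 0| < A 0 0) {X₀ : ℝ × ℝ}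
    (hX₀ : lieForm A X₀ X₀ < 0) (hX₀A : 0 < v₁ A X₀) {q : ℝ × ℝ} (hq : 0 < q.2) (ξ : ℝ × ℝ) :
    (metric A q ξ ξ ≤ 0 ∧ metric A q ξ (leftField X₀ q) < 0) ↔
      |ξ.2| ≤ wForm A ξ ∧ 0 < wForm A ξ := by
  have hX := abs_lt_wForm_of_future hdet hA hX₀ hX₀A
  have hΔ := Delta_pos hdet hA
  have hW : wForm A (leftField X₀ q) = q.2 * wForm A X₀ := by
    simp only [wForm, leftField]; ring
  have hpos : 0 < Delta A ^ 2 * q.2 ^ 2 := by positivity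
  rw [metric_eq hdet hA, metric_eq hdet hA, hW, div_le_iff₀ hpos, zero_mul, div_lt_iff₀ hpos,
    zero_mul]
  have e : ξ.2 * (leftField X₀ q).2 - wForm A ξ * (q.2 * wForm A X₀) =
      q.2 * (ξ.2 * X₀.2 - wForm A ξ * wForm A X₀) := by simp only [leftField]; ring
  rw [e, mul_neg_iff]
  have hab := abs_mul ξ.2 X₀.2
  have h1 := neg_abs_le (ξ.2 * X₀.2)
  have h2 := le_abs_self (ξ.2 * X₀.2)
  have h0 := abs_nonneg ξ.2
  have h0' := abs_nonneg X₀.2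
  constructor
  · rintro ⟨ha, hb⟩
    have hb' : ξ.2 * X₀.2 < wForm A ξ * wForm A X₀ := by
      rcases hb with h | h
      · linarith [h.2]
      · linarith [h.1]
    have hsq : ξ.2 ^ 2 ≤ wForm A ξ ^ 2 := by nlinarith
    have hle := sq_le_sq.1 hsq
    rcases lt_or_ge 0 (wForm A ξ) with hw | hw
    · rw [abs_of_pos hw] at hle
      exact ⟨hle, hw⟩
    · rw [abs_of_nonpos hw] at hle
      nlinarith
  · rintro ⟨ha, hb⟩
    have hsq := sq_le_sq' (by linarith [neg_abs_le ξ.2]) ((le_abs_self ξ.2).trans ha)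
    refine ⟨by nlinarith, Or.inl ⟨hq, ?_⟩⟩
    nlinarith

theorem sqrt_abs_metric (hdet : 0 < A.det) (hA : |A 1 0| < A 0 0) {q : ℝ × ℝ} (hq : 0 < q.2)
    {ξ : ℝ × ℝ} (hξ : |ξ.2| ≤ wForm A ξ) :
    Real.sqrt |metric A q ξ ξ| = Real.sqrt (wForm A ξ ^ 2 - ξ.2 ^ 2) / q.2 / Delta A := by
  have hΔ := Delta_pos hdet hA
  have hsq := sq_le_sq' (by linarith [neg_abs_le ξ.2]) ((le_abs_self ξ.2).trans hξ)
  have hpos : 0 < Delta A ^ 2 * q.2 ^ 2 := by positivity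
  rw [metric_eq hdet hA, abs_div, abs_of_pos hpos, abs_of_nonpos (by nlinarith),
    Real.sqrt_div' _ hpos.le, ← mul_pow, Real.sqrt_sq (by positivity), div_div, mul_comm q.2]
  congr 2
  ring

/-! ### The sets `D`, `F`, `E` in the coordinates `(w, y)` -/

theorem wCoord_add_mul (hdet : 0 < A.det) (hA : |A 1 0| < A 0 0) (w y : ℝ) :
    wCoord A (lam A * w + nu A * (y - 1), y) = w := by
  have := (lam_pos hdet hA).ne'
  simp only [wCoord]
  field_simp
  ring

theorem fst_eq_of_wCoord (hdet : 0 < A.det) (hA : |A 1 0| < A 0 0) (q : ℝ × ℝ) :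
    q.1 = lam A * wCoord A q + nu A * (q.2 - 1) := by
  have := (lam_pos hdet hA).ne'
  simp only [wCoord]
  field_simp
  ring

theorem lam₁_eq (hdet : 0 < A.det) (hA : |A 1 0| < A 0 0) (q : ℝ × ℝ) :
    lam₁ A q = A.det / (A 0 0 + A 1 0) * (q.2 - 1 - wCoord A q) := by
  have h := abs_lt.1 hA
  have h1 : A 0 0 + A 1 0 ≠ 0 := by linarith
  have h2 : A 0 0 - A 1 0 ≠ 0 := by linarith
  have h3 : A 0 0 ^ 2 - A 1 0 ^ 2 = (A 0 0 + A 1 0) * (A 0 0 - A 1 0) := by ring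
  have h4 := hdet.ne'
  have h5 := Matrix.det_fin_two A
  rw [wCoord, lam_eq hdet hA, nu_eq hdet hA, lam₁, h3]
  field_simp
  rw [h5]
  ring

theorem lam₂_eq (hdet : 0 < A.det) (hA : |A 1 0| < A 0 0) (q : ℝ × ℝ) :
    lam₂ A q = A.det / (A 0 0 - A 1 0) * (q.2 - 1 + wCoord A q) := by
  have h := abs_lt.1 hA
  have h1 : A 0 0 + A 1 0 ≠ 0 := by linarith
  have h2 : A 0 0 - A 1 0 ≠ 0 := by linarith
  have h3 : A 0 0 ^ 2 - A 1 0 ^ 2 = (A 0 0 + A 1 0) * (A 0 0 - A 1 0) := by ring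
  have h4 := hdet.ne'
  have h5 := Matrix.det_fin_two A
  rw [wCoord, lam_eq hdet hA, nu_eq hdet hA, lam₂, h3]
  field_simp
  rw [h5]
  ring

theorem wCoord_pointB (hdet : 0 < A.det) (hA : |A 1 0| < A 0 0) : wCoord A (pointB A) = 1 := by
  have h := abs_lt.1 hA
  have h1 : A 1 0 + A 0 0 ≠ 0 := by linarith
  have h2 : A 0 0 - A 1 0 ≠ 0 := by linarith
  have h6 : lam₂ A (pointB A) = 0 := by
    simp only [lam₂, pointB]
    field_simp
    ring
  rw [lam₂_eq hdet hA, mul_eq_zero] at h6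
  rcases h6 with h6 | h6
  · exact absurd h6 (div_ne_zero hdet.ne' h2)
  · simp only [pointB] at h6 ⊢
    linarith

theorem lam₃_eq (hdet : 0 < A.det) (hA : |A 1 0| < A 0 0) (q : ℝ × ℝ) :
    lam₃ A q = A.det / (A 0 0 + A 1 0) * (q.2 + 1 - wCoord A q) := by
  rw [lam₃, lam₁_eq hdet hA, lam₁_eq hdet hA, wCoord_pointB hdet hA]
  simp only [pointB]
  ring

theorem mem_setD_iff (hdet : 0 < A.det) (hA : |A 1 0| < A 0 0) (q : AffPlus) :
    q ∈ setD A ↔ |q.1.2 - 1| ≤ wCoord A q.1 ∧ wCoord A q.1 < q.1.2 + 1 := by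
  have h := abs_lt.1 hA
  have h1 : 0 < A.det / (A 0 0 + A 1 0) := div_pos hdet (by linarith)
  have h2 : 0 < A.det / (A 0 0 - A 1 0) := div_pos hdet (by linarith)
  rw [setD, mem_ofPred_eq, lam₁_eq hdet hA, lam₂_eq hdet hA, lam₃_eq hdet hA,
    mul_nonpos_iff_pos_imp_nonpos, mul_nonneg_iff_of_pos_left h2, mul_pos_iff_of_pos_left h1,
    abs_le]
  have h3 : ¬ A.det / (A 0 0 + A 1 0) < 0 := h1.le.not_gt
  constructor
  · rintro ⟨a, b, c⟩
    exact ⟨⟨by linarith, by linarith [a.1 h1]⟩, by linarith⟩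
  · rintro ⟨⟨a, b⟩, c⟩
    exact ⟨⟨fun _ => by linarith, fun _ => h1.le⟩, by linarith, by linarith⟩

theorem mem_setF_iff (hdet : 0 < A.det) (hA : |A 1 0| < A 0 0) (q : AffPlus) :
    q ∈ setF A ↔ wCoord A q.1 = q.1.2 + 1 := by
  have h := abs_lt.1 hA
  have h1 : 0 < A.det / (A 0 0 + A 1 0) := div_pos hdet (by linarith)
  rw [setF, mem_ofPred_eq, lam₃_eq hdet hA, mul_eq_zero_iff_left h1.ne', sub_eq_zero, eq_comm]

theorem mem_setE_iff (hdet : 0 < A.det) (hA : |A 1 0| < A 0 0) (q : AffPlus) :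
    q ∈ setE A ↔ q.1.2 + 1 < wCoord A q.1 := by
  have h := abs_lt.1 hA
  have h1 : 0 < A.det / (A 0 0 + A 1 0) := div_pos hdet (by linarith)
  rw [setE, mem_ofPred_eq, lam₃_eq hdet hA, mul_neg_iff]
  constructor
  · rintro (a | a)
    · linarith [a.2]
    · exact absurd a.1 h1.le.not_gt
  · intro a
    exact Or.inl ⟨h1, by linarith⟩

theorem continuous_wCoord : Continuous fun q : AffPlus => wCoord A q.1 := by
  unfold wCoord
  fun_prop

/-- The point of the group with `y`-coordinate `y` and value `w` of `wCoord`. -/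
noncomputable def ofWY (A : Matrix (Fin 2) (Fin 2) ℝ) (w y : ℝ) (hy : 0 < y) : AffPlus :=
  ⟨(lam A * w + nu A * (y - 1), y), hy⟩

theorem mem_interior_setD_iff (hdet : 0 < A.det) (hA : |A 1 0| < A 0 0) (q : AffPlus) :
    q ∈ interior (setD A) ↔ |q.1.2 - 1| < wCoord A q.1 ∧ wCoord A q.1 < q.1.2 + 1 := by
  constructor
  · intro hq
    refine ⟨?_, ((mem_setD_iff hdet hA q).1 (interior_subset hq)).2⟩
    -- Moving in the `w` direction alone suffices: `|y - 1| ≤ w` must survive a small decrease of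
    -- `w`, which makes it strict.
    let c : ℝ → AffPlus := fun t => ofWY A t q.1.2 q.2
    have hc : Continuous c := by
      refine Continuous.subtype_mk ?_ _
      fun_prop
    have hcq : c (wCoord A q.1) = q := by
      apply Subtype.ext
      exact Prod.ext (fst_eq_of_wCoord hdet hA q.1).symm rfl
    have hev : ∀ᶠ t in nhds (wCoord A q.1), c t ∈ setD A := by
      have : c ⁻¹' interior (setD A) ∈ nhds (wCoord A q.1) :=
        (isOpen_interior.preimage hc).mem_nhds (by rw [mem_preimage, hcq]; exact hq)
      filter_upwards [this] with t ht using interior_subset ht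
    obtain ⟨ε, hε, h⟩ := Metric.eventually_nhds_iff.1 hev
    have h' := h (y := wCoord A q.1 - ε / 2) (by
      rw [Real.dist_eq, sub_sub_cancel_left, abs_neg, abs_of_pos (by positivity)]; linarith)
    have h2 := ((mem_setD_iff hdet hA _).1 h').1
    simp only [c, ofWY, wCoord_add_mul hdet hA] at h2
    linarith
  · intro h
    have ho : IsOpen {q : AffPlus | |q.1.2 - 1| < wCoord A q.1 ∧ wCoord A q.1 < q.1.2 + 1} := by
      refine IsOpen.inter (isOpen_lt (by fun_prop) continuous_wCoord)
        (isOpen_lt continuous_wCoord (by fun_prop))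
    refine interior_maximal (fun r hr => ?_) ho h
    exact (mem_setD_iff hdet hA r).2 ⟨hr.1.le, hr.2⟩

/-! ### Monotone functions and their derivatives almost everywhere -/

theorem _root_.LipschitzOnWith.monotoneOn_of_ae_deriv_nonneg {f : ℝ → ℝ} {C : NNReal} {a b : ℝ}
    (hf : LipschitzOnWith C f (Icc a b))
    (h : ∀ᵐ t ∂volume.restrict (Icc a b), 0 ≤ deriv f t) : MonotoneOn f (Icc a b) := by
  intro s hs t ht hst
  have hsub : Icc s t ⊆ Icc a b := Icc_subset_Icc hs.1 ht.2
  have h1 : LipschitzOnWith C f (uIcc s t) := by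
    rw [uIcc_of_le hst]
    exact hf.mono hsub
  have h2 := h1.absolutelyContinuousOnInterval.integral_deriv_eq_sub
  have h3 : 0 ≤ ∫ x in s..t, deriv f x :=
    intervalIntegral.integral_nonneg_of_ae_restrict hst (ae_restrict_of_ae_restrict_of_subset hsub h)
  linarith

/-- The integral of the derivative of a monotone function is at most its increment, without absolute
continuity. This matters because `arcsin` is not Lipschitz at `±1`, where the calibration may start
or end. -/
theorem _root_.MonotoneOn.lintegral_le_of_le_deriv {f : ℝ → ℝ} {g : ℝ → ℝ≥0∞} {a b : ℝ}
    (hab : a ≤ b) (hf : MonotoneOn f (Icc a b))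
    (h : ∀ᵐ t ∂volume.restrict (Icc a b), g t ≤ ENNReal.ofReal (deriv f t)) :
    ∫⁻ t in Icc a b, g t ≤ ENNReal.ofReal (f b - f a) := by
  have hf' : MonotoneOn f (uIcc a b) := by rwa [uIcc_of_le hab]
  have hfab : f a ≤ f b := hf (left_mem_Icc.2 hab) (right_mem_Icc.2 hab) hab
  have hmem := hf'.intervalIntegral_deriv_mem_uIcc
  rw [uIcc_of_le (by linarith), intervalIntegral.integral_of_le hab,
    ← integral_Icc_eq_integral_Ioc] at hmem
  have hint := (intervalIntegrable_iff_integrableOn_Icc_of_le hab).1 hf'.intervalIntegrable_deriv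
  have hnn : ∀ᵐ t ∂volume.restrict (Icc a b), 0 ≤ deriv f t := by
    rw [← restrict_Ioo_eq_restrict_Icc, ae_restrict_iff' measurableSet_Ioo]
    refine Filter.Eventually.of_forall fun x hx => ?_
    rw [← derivWithin_of_mem_nhds (Icc_mem_nhds hx.1 hx.2)]
    exact hf.derivWithin_nonneg
  refine (lintegral_mono_ae h).trans ?_
  rw [← ofReal_integral_eq_lintegral_ofReal hint hnn]
  exact ENNReal.ofReal_le_ofReal hmem.2

/-! ### Causal curves and the upper bound on length -/

theorem hasDerivAt_wCoord {γ : ℝ → ℝ × ℝ} {t : ℝ} (h : DifferentiableAt ℝ γ t) :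
    HasDerivAt (fun s => wCoord A (γ s)) (wForm A (deriv γ t)) t := by
  have h1 : HasDerivAt (fun s => (γ s).1) (deriv γ t).1 t := h.hasDerivAt.fst
  have h2 : HasDerivAt (fun s => (γ s).2) (deriv γ t).2 t := h.hasDerivAt.snd
  exact (h1.sub ((h2.sub_const 1).const_mul (nu A))).div_const (lam A)

namespace IsCausalCurve

variable {X₀ : ℝ × ℝ} {p q : AffPlus} {T : ℝ} {γ : ℝ → ℝ × ℝ}

theorem ae_differentiableAt_and_abs_le (hdet : 0 < A.det) (hA : |A 1 0| < A 0 0)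
    (hX₀ : lieForm A X₀ X₀ < 0) (hX₀A : 0 < v₁ A X₀) (hγ : IsCausalCurve A X₀ p q T γ) :
    ∀ᵐ t ∂volume.restrict (Icc 0 T),
      DifferentiableAt ℝ γ t ∧ |(deriv γ t).2| ≤ wForm A (deriv γ t) := by
  filter_upwards [hγ.nonspacelike, hγ.future, ae_restrict_mem measurableSet_Icc] with t h1 h2 ht
  have h := (metric_causal_iff hdet hA hX₀ hX₀A (hγ.mem t ht) _).1 ⟨h1, h2⟩
  -- At a point of nondifferentiability `deriv` is `0`, which contradicts `0 < dw`.
  refine ⟨differentiableAt_of_deriv_ne_zero fun h0 => ?_, h.1⟩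
  rw [h0] at h
  simp [wForm] at h

theorem lipschitz_combination (hγ : IsCausalCurve A X₀ p q T γ) (s : ℝ) :
    ∃ C, LipschitzOnWith C (fun t => wCoord A (γ t) + s * (γ t).2) (Icc 0 T) := by
  obtain ⟨C, hC⟩ := hγ.lipschitz
  let L : ℝ × ℝ →L[ℝ] ℝ := (lam A)⁻¹ • (ContinuousLinearMap.fst ℝ ℝ ℝ -
    nu A • ContinuousLinearMap.snd ℝ ℝ ℝ) + s • ContinuousLinearMap.snd ℝ ℝ ℝ
  refine ⟨‖L‖₊ * C, ?_⟩
  have h := L.lipschitz.comp_lipschitzOnWith hC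
  intro x hx y hy
  convert! h hx hy using 1
  simp only [edist_dist, Real.dist_eq, Function.comp, L, wCoord]
  congr 2
  simp
  ring

/-- The derivative `dw + s dy` is at least `dw - |dy| ≥ 0`. The values `s = ±1` give the null
coordinates. -/
theorem monotoneOn_combination (hdet : 0 < A.det) (hA : |A 1 0| < A 0 0)
    (hX₀ : lieForm A X₀ X₀ < 0) (hX₀A : 0 < v₁ A X₀) (hγ : IsCausalCurve A X₀ p q T γ)
    {s : ℝ} (hs : |s| ≤ 1) :
    MonotoneOn (fun t => wCoord A (γ t) + s * (γ t).2) (Icc 0 T) := by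
  obtain ⟨C, hC⟩ := hγ.lipschitz_combination s
  refine hC.monotoneOn_of_ae_deriv_nonneg ?_
  filter_upwards [hγ.ae_differentiableAt_and_abs_le hdet hA hX₀ hX₀A] with t ht
  have h2 : HasDerivAt (fun t => (γ t).2) (deriv γ t).2 t := ht.1.hasDerivAt.snd
  have hd : deriv (fun t => wCoord A (γ t) + s * (γ t).2) t = _ :=
    ((hasDerivAt_wCoord ht.1).add (h2.const_mul s)).deriv
  rw [hd]
  have h3 : |s * (deriv γ t).2| ≤ |(deriv γ t).2| := by
    rw [abs_mul]
    exact mul_le_of_le_one_left (abs_nonneg _) hs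
  linarith [neg_abs_le (s * (deriv γ t).2), ht.2]

theorem abs_sub_le_wCoord_sub (hdet : 0 < A.det) (hA : |A 1 0| < A 0 0)
    (hX₀ : lieForm A X₀ X₀ < 0) (hX₀A : 0 < v₁ A X₀) (hγ : IsCausalCurve A X₀ p q T γ) :
    |q.1.2 - p.1.2| ≤ wCoord A q.1 - wCoord A p.1 := by
  have h0 := left_mem_Icc.2 hγ.nonneg
  have h1 := right_mem_Icc.2 hγ.nonneg
  have ha := hγ.monotoneOn_combination hdet hA hX₀ hX₀A (s := 1) (by simp) h0 h1 hγ.nonneg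
  have hb := hγ.monotoneOn_combination hdet hA hX₀ hX₀A (s := -1) (by simp) h0 h1 hγ.nonneg
  simp only [hγ.source, hγ.target] at ha hb
  rw [abs_le]
  constructor <;> linarith

/-- The function `arcsin ((w - w₀) / y)` bounds the length of causal curves. -/
theorem length_le (hdet : 0 < A.det) (hA : |A 1 0| < A 0 0)
    (hX₀ : lieForm A X₀ X₀ < 0) (hX₀A : 0 < v₁ A X₀) (hγ : IsCausalCurve A X₀ p q T γ)
    {w₀ : ℝ} (hp : |wCoord A p.1 - w₀| ≤ p.1.2) (hq : |wCoord A q.1 - w₀| ≤ q.1.2) :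
    length A T γ ≤ ENNReal.ofReal ((Real.arcsin ((wCoord A q.1 - w₀) / q.1.2) -
      Real.arcsin ((wCoord A p.1 - w₀) / p.1.2)) / Delta A) := by
  have hΔ := Delta_pos hdet hA
  have h0 := left_mem_Icc.2 hγ.nonneg
  have h1 := right_mem_Icc.2 hγ.nonneg
  have hm := hγ.monotoneOn_combination hdet hA hX₀ hX₀A (s := 1) (by simp)
  have hm' := hγ.monotoneOn_combination hdet hA hX₀ hX₀A (s := -1) (by simp)
  set h : ℝ → ℝ := fun t => (wCoord A (γ t) - w₀) / (γ t).2 with hdef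
  rw [abs_le] at hp hq
  -- `w + y` is bounded below by its initial value and `w - y` above by its final value.
  have hbd : ∀ t ∈ Icc 0 T, |wCoord A (γ t) - w₀| ≤ (γ t).2 := by
    intro t ht
    have ha := hm h0 ht ht.1
    have hb := hm' ht h1 ht.2
    simp only [hγ.source, hγ.target] at ha hb
    rw [abs_le]
    constructor <;> linarith
  have hmono : MonotoneOn h (Icc 0 T) := by
    intro s hs t ht hst
    have ha := hm hs ht hst
    have hb := hm' hs ht hst
    have hs' := abs_le.1 (hbd s hs)
    have ht' := abs_le.1 (hbd t ht)
    have hys := hγ.mem s hs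
    have hyt := hγ.mem t ht
    simp only [hdef] at ha hb ⊢
    rw [div_le_div_iff₀ hys hyt]
    nlinarith
  have hTmono : MonotoneOn (fun t => Real.arcsin (h t) / Delta A) (Icc 0 T) := fun s hs t ht hst =>
    div_le_div_of_nonneg_right (Real.monotone_arcsin (hmono hs ht hst)) hΔ.le
  have key := hTmono.lintegral_le_of_le_deriv hγ.nonneg
    (g := fun t => ENNReal.ofReal (Real.sqrt |metric A (γ t) (deriv γ t) (deriv γ t)|)) ?_
  · simp only [hdef, hγ.source, hγ.target, ← sub_div] at key
    exact key
  have hae := hγ.ae_differentiableAt_and_abs_le hdet hA hX₀ hX₀A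
  rw [← restrict_Ioo_eq_restrict_Icc] at hae ⊢
  filter_upwards [hae, ae_restrict_mem measurableSet_Ioo] with t hd ht
  refine ENNReal.ofReal_le_ofReal ?_
  have htI := Ioo_subset_Icc_self ht
  have hy := hγ.mem t htI
  have hb := hbd t htI
  rw [sqrt_abs_metric hdet hA hy hd.2]
  have hnhds : Icc 0 T ∈ nhds t := Icc_mem_nhds ht.1 ht.2
  have hy' : HasDerivAt (fun t => (γ t).2) (deriv γ t).2 t := hd.1.hasDerivAt.snd
  have hh : HasDerivAt h ((wForm A (deriv γ t) - h t * (deriv γ t).2) / (γ t).2) t := by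
    convert! ((hasDerivAt_wCoord hd.1).sub_const w₀).div hy' hy.ne' using 1
    simp only [hdef]
    field_simp
  have hh1 : ∀ s ∈ Icc 0 T, |h s| ≤ 1 := by
    intro s hs
    rw [hdef, abs_div, abs_of_pos (hγ.mem s hs)]
    exact div_le_one_of_le₀ (hbd s hs) (hγ.mem s hs).le
  set W := wForm A (deriv γ t)
  set Y := (deriv γ t).2
  rcases (hh1 t htI).lt_or_eq with hlt | heq
  · have hlt' := abs_lt.1 hlt
    have hpos : 0 < 1 - h t ^ 2 := by nlinarith
    have hder := ((Real.hasDerivAt_arcsin (by linarith) (by linarith)).comp t hh).div_const (Delta A)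
    have hder' : deriv (fun t => Real.arcsin (h t) / Delta A) t = _ := hder.deriv
    rw [hder']
    refine div_le_div_of_nonneg_right ?_ hΔ.le
    rw [← mul_div_assoc]
    refine div_le_div_of_nonneg_right ?_ hy.le
    rw [one_div, ← div_eq_inv_mul, le_div_iff₀ (Real.sqrt_pos.2 hpos), ← Real.sqrt_mul' _ hpos.le]
    refine Real.sqrt_le_iff.2 ⟨?_, ?_⟩
    · have h3 : |h t * Y| ≤ |Y| := by
        rw [abs_mul]
        exact mul_le_of_le_one_left (abs_nonneg _) hlt.le
      linarith [le_abs_self (h t * Y), hd.2]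
    -- The calibration inequality: `(W - hY)² - (1 - h²)(W² - Y²) = (hW - Y)²`.
    · nlinarith [sq_nonneg (h t * W - Y)]
  -- Where `|h| = 1` the chain rule for `arcsin` fails. But `h` is extremal there, so `W = hY`, the
  -- velocity is null, and monotonicity alone gives the required inequality.
  · have hext : IsLocalExtr h t := by
      rcases abs_eq (zero_le_one' ℝ) |>.1 heq with h1 | h1
      · refine Or.inr ?_
        filter_upwards [hnhds] with s hs
        rw [h1]
        exact (abs_le.1 (hh1 s hs)).2
      · refine Or.inl ?_
        filter_upwards [hnhds] with s hs
        rw [h1]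
        exact (abs_le.1 (hh1 s hs)).1
    have hz := hext.hasDerivAt_eq_zero hh
    rw [div_eq_zero_iff, or_iff_left hy.ne', sub_eq_zero] at hz
    have hsq : W ^ 2 - Y ^ 2 = 0 := by
      rw [hz, mul_pow, ← sq_abs (h t), heq]
      ring
    rw [hsq, Real.sqrt_zero, zero_div, zero_div, ← derivWithin_of_mem_nhds hnhds]
    exact hTmono.derivWithin_nonneg

end IsCausalCurve

theorem lorentzDist_le (hdet : 0 < A.det) (hA : |A 1 0| < A 0 0) {X₀ : ℝ × ℝ}
    (hX₀ : lieForm A X₀ X₀ < 0) (hX₀A : 0 < v₁ A X₀) {p q : AffPlus}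
    {w₀ : ℝ} (hp : |wCoord A p.1 - w₀| ≤ p.1.2) (hq : |wCoord A q.1 - w₀| ≤ q.1.2) :
    lorentzDist A X₀ p q ≤ ENNReal.ofReal ((Real.arcsin ((wCoord A q.1 - w₀) / q.1.2) -
      Real.arcsin ((wCoord A p.1 - w₀) / p.1.2)) / Delta A) :=
  iSup_le fun _ => iSup_le fun _ => iSup_le fun hγ => hγ.length_le hdet hA hX₀ hX₀A hp hq

/-! ### Curves given as graphs, and lower bounds -/

/-- The curve which in the coordinates `(w, y)` is the graph of `f`. -/
noncomputable def graphCurve (A : Matrix (Fin 2) (Fin 2) ℝ) (f : ℝ → ℝ) (t : ℝ) : ℝ × ℝ :=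
  (lam A * t + nu A * (f t - 1), f t)

theorem wForm_deriv_graphCurve (hdet : 0 < A.det) (hA : |A 1 0| < A 0 0) {f : ℝ → ℝ} {t : ℝ}
    (hf : DifferentiableAt ℝ f t) :
    wForm A (deriv (graphCurve A f) t) = 1 ∧ (deriv (graphCurve A f) t).2 = deriv f t := by
  have h1 : HasDerivAt (fun t => lam A * t + nu A * (f t - 1)) (lam A * 1 + nu A * deriv f t) t :=
    ((hasDerivAt_id t).const_mul _).add ((hf.hasDerivAt.sub_const 1).const_mul _)
  have h2 : deriv (graphCurve A f) t = (lam A * 1 + nu A * deriv f t, deriv f t) :=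
    (h1.prodMk hf.hasDerivAt).deriv
  have := (lam_pos hdet hA).ne'
  rw [h2]
  refine ⟨?_, rfl⟩
  simp only [wForm]
  field_simp
  ring

/-- Parametrised by `w`, a graph has `dw = 1`, so causality is `|f'| ≤ 1`, which a 1-Lipschitz
function satisfies almost everywhere. -/
theorem isCausalCurve_graphCurve (hdet : 0 < A.det) (hA : |A 1 0| < A 0 0) {X₀ : ℝ × ℝ}
    (hX₀ : lieForm A X₀ X₀ < 0) (hX₀A : 0 < v₁ A X₀) {q : AffPlus} {f : ℝ → ℝ}
    (hf : LipschitzWith 1 f) (hw : 0 ≤ wCoord A q.1) (hpos : ∀ t ∈ Icc 0 (wCoord A q.1), 0 < f t)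
    (h0 : f 0 = 1) (h1 : f (wCoord A q.1) = q.1.2) :
    IsCausalCurve A X₀ 1 q (wCoord A q.1) (graphCurve A f) := by
  have hae : ∀ᵐ t ∂volume.restrict (Icc 0 (wCoord A q.1)),
      metric A (graphCurve A f t) (deriv (graphCurve A f) t) (deriv (graphCurve A f) t) ≤ 0 ∧
      metric A (graphCurve A f t) (deriv (graphCurve A f) t)
        (leftField X₀ (graphCurve A f t)) < 0 := by
    filter_upwards [ae_restrict_of_ae hf.ae_differentiableAt_real,
      ae_restrict_mem measurableSet_Icc] with t hd ht
    obtain ⟨ha, hb⟩ := wForm_deriv_graphCurve hdet hA hd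
    rw [metric_causal_iff hdet hA hX₀ hX₀A (hpos t ht), ha, hb]
    exact ⟨by simpa using norm_deriv_le_of_lipschitz (x₀ := t) hf, one_pos⟩
  exact {
    nonneg := hw
    lipschitz := by
      have hid : LipschitzWith 1 (fun t : ℝ => t) := LipschitzWith.id
      have hc (c : ℝ) : LipschitzWith ‖c‖₊ fun t : ℝ => c * t := lipschitzWith_smul c
      have hf1 : LipschitzWith _ fun t => f t - 1 := hf.sub (LipschitzWith.const 1)
      have h2 : LipschitzWith _ (fun t => lam A * t + nu A * (f t - 1)) :=
        (hc (lam A)).add ((hc (nu A)).comp hf1)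
      exact ⟨_, (h2.prodMk hf).lipschitzOnWith⟩
    mem := hpos
    source := by simp [graphCurve, h0, coe_one]
    target := by
      simp only [graphCurve, h1]
      exact Prod.ext (fst_eq_of_wCoord hdet hA q.1).symm rfl
    nonspacelike := hae.mono fun _ h => h.1
    future := hae.mono fun _ h => h.2 }

theorem lintegral_le_lorentzDist (hdet : 0 < A.det) (hA : |A 1 0| < A 0 0) {X₀ : ℝ × ℝ}
    (hX₀ : lieForm A X₀ X₀ < 0) (hX₀A : 0 < v₁ A X₀) {q : AffPlus} {f : ℝ → ℝ}
    (hf : LipschitzWith 1 f) (hw : 0 ≤ wCoord A q.1) (hpos : ∀ t ∈ Icc 0 (wCoord A q.1), 0 < f t)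
    (h0 : f 0 = 1) (h1 : f (wCoord A q.1) = q.1.2) :
    ∫⁻ t in Icc 0 (wCoord A q.1),
      ENNReal.ofReal (Real.sqrt (1 - deriv f t ^ 2) / f t / Delta A) ≤ lorentzDist A X₀ 1 q := by
  refine le_trans (le_of_eq ?_) (le_iSup_of_le _ (le_iSup_of_le _ (le_iSup_of_le
    (isCausalCurve_graphCurve hdet hA hX₀ hX₀A hf hw hpos h0 h1) le_rfl)))
  refine lintegral_congr_ae ?_
  filter_upwards [ae_restrict_of_ae hf.ae_differentiableAt_real,
    ae_restrict_mem measurableSet_Icc] with t hd ht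
  obtain ⟨ha, hb⟩ := wForm_deriv_graphCurve hdet hA hd
  rw [sqrt_abs_metric hdet hA (hpos t ht), ha, hb, one_pow]
  · rfl
  · rw [ha, hb]
    simpa using norm_deriv_le_of_lipschitz (x₀ := t) hf

/-- The straight segment from `(0, 1)` in the `(w, y)` plane is causal. -/
theorem mem_causalFuture (hdet : 0 < A.det) (hA : |A 1 0| < A 0 0) {X₀ : ℝ × ℝ}
    (hX₀ : lieForm A X₀ X₀ < 0) (hX₀A : 0 < v₁ A X₀) {q : AffPlus}
    (hq : |q.1.2 - 1| < wCoord A q.1) : q ∈ causalFuture A X₀ 1 := by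
  set w := wCoord A q.1 with hwdef
  have hw : 0 < w := (abs_nonneg _).trans_lt hq
  refine ⟨_, _, isCausalCurve_graphCurve hdet hA hX₀ hX₀A
    (f := fun t => 1 + (q.1.2 - 1) / w * t) ?_ hw.le ?_ (by simp) ?_⟩
  · refine LipschitzWith.of_dist_le_mul fun x y => ?_
    rw [Real.dist_eq, Real.dist_eq, add_sub_add_left_eq_sub, ← mul_sub, abs_mul, abs_div,
      abs_of_pos hw]
    exact mul_le_mul_of_nonneg_right ((div_le_one hw).2 hq.le) (abs_nonneg _)
  · intro t ht
    have : 1 + (q.1.2 - 1) / w * t = ((w - t) + q.1.2 * t) / w := by field_simp; ring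
    rw [this]
    refine div_pos ?_ hw
    have hy := q.2
    rcases ht.1.eq_or_lt with h | h
    · rw [← h]; linarith
    · linarith [ht.2, mul_pos hy h]
  · simp only [← hwdef]
    field_simp
    ring

theorem lipschitzWith_sqrt_add_sq {R : ℝ} (hR : 0 < R) (w₀ : ℝ) :
    LipschitzWith 1 fun t : ℝ => Real.sqrt (R ^ 2 + (t - w₀) ^ 2) := by
  refine LipschitzWith.of_le_add fun x y => ?_
  have hy : 0 ≤ R ^ 2 + (y - w₀) ^ 2 := by positivity
  have h1 := Real.sq_sqrt hy
  have h2 : |y - w₀| ≤ √(R ^ 2 + (y - w₀) ^ 2) := Real.abs_le_sqrt (by nlinarith)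
  rw [Real.sqrt_le_iff]
  refine ⟨by positivity, ?_⟩
  rw [Real.dist_eq]
  have h3 : |(y - w₀) * (x - y)| ≤ √(R ^ 2 + (y - w₀) ^ 2) * |x - y| := by
    rw [abs_mul]
    exact mul_le_mul_of_nonneg_right h2 (abs_nonneg _)
  nlinarith [le_abs_self ((y - w₀) * (x - y)), sq_abs (x - y)]

theorem hasDerivAt_sqrt_add_sq {R : ℝ} (hR : 0 < R) (w₀ t : ℝ) :
    HasDerivAt (fun t : ℝ => Real.sqrt (R ^ 2 + (t - w₀) ^ 2))
      ((t - w₀) / Real.sqrt (R ^ 2 + (t - w₀) ^ 2)) t := by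
  have h : HasDerivAt (fun t : ℝ => R ^ 2 + (t - w₀) ^ 2) (2 * (t - w₀)) t := by
    simpa using (((hasDerivAt_id t).sub_const w₀).pow 2).const_add (R ^ 2)
  convert! h.sqrt (by positivity) using 1
  rw [mul_div_mul_left _ _ two_ne_zero]

theorem arctan_div_eq_arcsin {R : ℝ} (hR : 0 < R) (x : ℝ) :
    Real.arctan (x / R) = Real.arcsin (x / Real.sqrt (R ^ 2 + x ^ 2)) := by
  rw [Real.arctan_eq_arcsin]
  have : 1 + (x / R) ^ 2 = (R ^ 2 + x ^ 2) / R ^ 2 := by field_simp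
  rw [this, Real.sqrt_div' _ (sq_nonneg R), Real.sqrt_sq hR.le]
  field_simp

theorem lintegral_geodesic {R Δ s : ℝ} (hR : 0 < R) (hΔ : 0 < Δ) (hs : 0 ≤ s) (w₀ : ℝ) :
    ∫⁻ t in Icc 0 s, ENNReal.ofReal (R / (R ^ 2 + (t - w₀) ^ 2) / Δ) =
      ENNReal.ofReal ((Real.arctan ((s - w₀) / R) - Real.arctan ((0 - w₀) / R)) / Δ) := by
  have hcont : Continuous fun t : ℝ => R / (R ^ 2 + (t - w₀) ^ 2) / Δ := by
    refine Continuous.div_const (continuous_const.div (by fun_prop) fun t => ?_) _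
    positivity
  rw [← ofReal_integral_eq_lintegral_ofReal hcont.continuousOn.integrableOn_Icc
    (Filter.Eventually.of_forall fun t => by positivity), integral_Icc_eq_integral_Ioc,
    ← intervalIntegral.integral_of_le hs,
    intervalIntegral.integral_eq_sub_of_hasDerivAt
      (f := fun t => Real.arctan ((t - w₀) / R) / Δ) _ (hcont.intervalIntegrable _ _), ← sub_div]
  intro t _
  have h := ((((hasDerivAt_id t).sub_const w₀).div_const R).arctan).div_const Δ
  convert! h using 1
  simp only [id]
  field_simp

/-- Follow the geodesic with centre `w₀` up to `w = s`, and then the line `y = const`. -/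
theorem geodesic_le_lorentzDist (hdet : 0 < A.det) (hA : |A 1 0| < A 0 0) {X₀ : ℝ × ℝ}
    (hX₀ : lieForm A X₀ X₀ < 0) (hX₀A : 0 < v₁ A X₀) {q : AffPlus} {s w₀ : ℝ} (hs : 0 ≤ s)
    (hsq : s ≤ wCoord A q.1) (hw₀ : |w₀| < 1) (hy : q.1.2 ^ 2 = 1 - w₀ ^ 2 + (s - w₀) ^ 2) :
    ENNReal.ofReal ((Real.arcsin ((s - w₀) / q.1.2) - Real.arcsin (-w₀)) / Delta A) ≤
      lorentzDist A X₀ 1 q := by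
  have hΔ := Delta_pos hdet hA
  have hR2 : 0 < 1 - w₀ ^ 2 := by
    have := (sq_lt_one_iff_abs_lt_one w₀).2 hw₀
    linarith
  set R := Real.sqrt (1 - w₀ ^ 2) with hRdef
  have hR : 0 < R := Real.sqrt_pos.2 hR2
  have hRsq : R ^ 2 = 1 - w₀ ^ 2 := Real.sq_sqrt hR2.le
  set F : ℝ → ℝ := fun t => Real.sqrt (R ^ 2 + (t - w₀) ^ 2) with hF
  have hFpos (t : ℝ) : 0 < F t := Real.sqrt_pos.2 (by positivity)
  have hFsq (t : ℝ) : F t ^ 2 = R ^ 2 + (t - w₀) ^ 2 := Real.sq_sqrt (by positivity)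
  have hF0 : F 0 = 1 := by
    rw [hF]
    simp [hRsq]
  have hFs : F s = q.1.2 := by
    rw [hF]
    simp only
    rw [hRsq, ← hy, Real.sqrt_sq q.2.le]
  -- Freezing the argument at `s` appends the horizontal segment; its length is then discarded by
  -- restricting the integral to `[0, s]`.
  have hmin : LipschitzWith 1 fun t : ℝ => min t s := LipschitzWith.id.min_const s
  have hlip : LipschitzWith 1 fun t => F (min t s) := by
    have h := (lipschitzWith_sqrt_add_sq hR w₀).comp hmin
    rwa [mul_one] at h
  refine le_trans ?_ (lintegral_le_lorentzDist hdet hA hX₀ hX₀A hlip (hs.trans hsq)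
    (fun t _ => hFpos _) (by simp [hs, hF0]) (by simp [hsq, hFs]))
  refine le_trans ?_ (lintegral_mono_set (Icc_subset_Icc_right hsq))
  have e1 := arctan_div_eq_arcsin hR (s - w₀)
  have e2 := arctan_div_eq_arcsin hR (0 - w₀)
  rw [show √(R ^ 2 + (s - w₀) ^ 2) = q.1.2 from hFs] at e1
  rw [show √(R ^ 2 + (0 - w₀) ^ 2) = 1 from hF0, div_one, zero_sub] at e2
  rw [← e1, ← e2, ← zero_sub w₀, ← lintegral_geodesic hR hΔ hs, ← restrict_Ioo_eq_restrict_Icc]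
  refine le_of_eq (setLIntegral_congr_fun measurableSet_Ioo fun t ht => ?_)
  have hev : (fun t => F (min t s)) =ᶠ[nhds t] F := by
    filter_upwards [Iio_mem_nhds ht.2] with x hx
    rw [min_eq_left (le_of_lt hx)]
  have hd : deriv (fun t => F (min t s)) t = (t - w₀) / F t := by
    rw [hev.deriv_eq]
    exact (hasDerivAt_sqrt_add_sq hR w₀ t).deriv
  simp only [hd, min_eq_left ht.2.le]
  have hne := (hFpos t).ne'
  have : 1 - ((t - w₀) / F t) ^ 2 = (R / F t) ^ 2 := by
    rw [div_pow, div_pow, one_sub_div (pow_ne_zero 2 hne)]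
    congr 1
    rw [hFsq]
    ring
  rw [this, Real.sqrt_sq (div_pos hR (hFpos t)).le, div_div R (F t), ← sq, hFsq]

/-! ### The distance from the identity, region by region -/

theorem lorentzDist_eq_top (hdet : 0 < A.det) (hA : |A 1 0| < A 0 0) {X₀ : ℝ × ℝ}
    (hX₀ : lieForm A X₀ X₀ < 0) (hX₀A : 0 < v₁ A X₀) {q : AffPlus}
    (hq : q.1.2 + 1 < wCoord A q.1) : lorentzDist A X₀ 1 q = ⊤ := by
  have hΔ := Delta_pos hdet hA
  have hy := q.2
  set w := wCoord A q.1 with hwdef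
  set y := q.1.2 with hydef
  have key : ∀ ε : ℝ, 0 < ε → ε < min 1 y →
      ENNReal.ofReal ((w - y - 1) / Delta A * ε⁻¹) ≤ lorentzDist A X₀ 1 q := by
    intro ε hε hlt
    have hε1 := hlt.trans_le (min_le_left _ _)
    have hεy := hlt.trans_le (min_le_right _ _)
    -- Null descent from height `1`, horizontal run at height `ε`, null ascent to `y` at the end.
    -- The run contains `1 < t < w - y` for every admissible `ε`, whence length at least `(w - y -
    -- 1) / (Δ ε)`.
    set f : ℝ → ℝ := fun t => max (max (1 - t) ε) (t - (w - y)) with hf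
    have hsub (c : ℝ) : LipschitzWith 1 fun t : ℝ => t - c := by
      refine LipschitzWith.of_dist_le_mul fun a b => ?_
      simp
    have hsub' : LipschitzWith 1 fun t : ℝ => 1 - t := by
      refine LipschitzWith.of_dist_le_mul fun a b => ?_
      rw [dist_sub_left, NNReal.coe_one, one_mul]
    have hlip : LipschitzWith 1 f := by
      have := (hsub'.max_const ε).max (hsub (w - y))
      simpa using this
    refine le_trans ?_ (lintegral_le_lorentzDist hdet hA hX₀ hX₀A hlip (by linarith)
      (fun t _ => lt_max_of_lt_left (lt_max_of_lt_right hε)) ?_ ?_)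
    · have hIoo : Ioo 1 (w - y) ⊆ Icc 0 w := fun t ht => ⟨by linarith [ht.1], by linarith [ht.2]⟩
      refine le_trans ?_ (lintegral_mono_set hIoo)
      have hfe : ∀ t ∈ Ioo 1 (w - y), f t = ε := fun t ht => by
        rw [hf]
        simp only
        rw [max_eq_right (a := 1 - t) (by linarith [ht.1]), max_eq_left (by linarith [ht.2])]
      have hcongr : ∀ t ∈ Ioo 1 (w - y),
          ENNReal.ofReal (√(1 - deriv f t ^ 2) / f t / Delta A) =
            ENNReal.ofReal (ε⁻¹ / Delta A) := fun t ht => by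
        have hd : deriv f t = 0 := by
          have hev : f =ᶠ[nhds t] fun _ => ε := by
            filter_upwards [Ioo_mem_nhds ht.1 ht.2] with x hx using hfe x hx
          rw [hev.deriv_eq, deriv_const]
        rw [hd, hfe t ht]
        simp
      rw [setLIntegral_congr_fun measurableSet_Ioo hcongr, setLIntegral_const, Real.volume_Ioo,
        ← ENNReal.ofReal_mul (by positivity)]
      refine ENNReal.ofReal_le_ofReal (le_of_eq ?_)
      ring
    · simp only [hf]
      rw [max_eq_left, max_eq_left] <;> simp <;> first | linarith | skip
      left; linarith
    · simp only [hf]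
      rw [max_eq_right]
      · ring
      · exact max_le (by linarith) (by linarith)
  have hlim : Filter.Tendsto (fun ε : ℝ => ENNReal.ofReal ((w - y - 1) / Delta A * ε⁻¹))
      (nhdsWithin 0 (Ioi 0)) (nhds ⊤) :=
    ENNReal.tendsto_ofReal_atTop.comp
      (tendsto_inv_nhdsGT_zero.const_mul_atTop (div_pos (by linarith) hΔ))
  refine top_le_iff.1 (le_of_tendsto hlim ?_)
  filter_upwards [Ioo_mem_nhdsGT (lt_min one_pos hy)] with ε hε using key ε hε.1 hε.2

theorem wCoord_one : wCoord A (1 : AffPlus).1 = 0 := by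
  simp [wCoord, coe_one]

theorem lorentzDist_one_le (hdet : 0 < A.det) (hA : |A 1 0| < A 0 0) {X₀ : ℝ × ℝ}
    (hX₀ : lieForm A X₀ X₀ < 0) (hX₀A : 0 < v₁ A X₀) {q : AffPlus} {w₀ : ℝ} (hw₀ : |w₀| ≤ 1)
    (hq : |wCoord A q.1 - w₀| ≤ q.1.2) :
    lorentzDist A X₀ 1 q ≤ ENNReal.ofReal
      ((Real.arcsin ((wCoord A q.1 - w₀) / q.1.2) - Real.arcsin (-w₀)) / Delta A) := by
  have h := lorentzDist_le hdet hA hX₀ hX₀A (p := 1) (q := q) (w₀ := w₀)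
    (by rw [wCoord_one, zero_sub, abs_neg]; exact hw₀) hq
  rwa [wCoord_one, coe_one, div_one, zero_sub] at h

theorem lorentzDist_eq_zero_of_notMem (X₀ : ℝ × ℝ) {p q : AffPlus}
    (hq : q ∉ causalFuture A X₀ p) : lorentzDist A X₀ p q = 0 := by
  simp only [lorentzDist, ENNReal.iSup_eq_zero]
  exact fun T γ hγ => absurd ⟨T, γ, hγ⟩ hq

theorem causalFuture_subset (hdet : 0 < A.det) (hA : |A 1 0| < A 0 0) {X₀ : ℝ × ℝ}
    (hX₀ : lieForm A X₀ X₀ < 0) (hX₀A : 0 < v₁ A X₀) :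
    causalFuture A X₀ 1 ⊆ {q | |q.1.2 - 1| ≤ wCoord A q.1} := by
  rintro q ⟨T, γ, hγ⟩
  have h := hγ.abs_sub_le_wCoord_sub hdet hA hX₀ hX₀A
  rwa [wCoord_one, coe_one, sub_zero] at h

/-- `J⁺` lies between the open cone `|y - 1| < w` and its closed version, so its boundary lies on
the light cone. -/
theorem wCoord_eq_of_mem_frontier (hdet : 0 < A.det) (hA : |A 1 0| < A 0 0) {X₀ : ℝ × ℝ}
    (hX₀ : lieForm A X₀ X₀ < 0) (hX₀A : 0 < v₁ A X₀) {q : AffPlus}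
    (hq : q ∈ frontier (causalFuture A X₀ 1)) : wCoord A q.1 = |q.1.2 - 1| := by
  have hclosed : IsClosed {q : AffPlus | |q.1.2 - 1| ≤ wCoord A q.1} :=
    isClosed_le (by fun_prop) continuous_wCoord
  have hopen : IsOpen {q : AffPlus | |q.1.2 - 1| < wCoord A q.1} :=
    isOpen_lt (by fun_prop) continuous_wCoord
  have hle : |q.1.2 - 1| ≤ wCoord A q.1 :=
    closure_minimal (causalFuture_subset hdet hA hX₀ hX₀A) hclosed hq.1
  refine le_antisymm (not_lt.1 fun hlt => hq.2 ?_) hle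
  exact interior_maximal (fun r hr => mem_causalFuture hdet hA hX₀ hX₀A hr) hopen hlt

theorem lorentzDist_eq_zero_of_mem_frontier (hdet : 0 < A.det) (hA : |A 1 0| < A 0 0)
    {X₀ : ℝ × ℝ} (hX₀ : lieForm A X₀ X₀ < 0) (hX₀A : 0 < v₁ A X₀) {q : AffPlus}
    (hq : q ∈ frontier (causalFuture A X₀ 1)) : lorentzDist A X₀ 1 q = 0 := by
  have hw := wCoord_eq_of_mem_frontier hdet hA hX₀ hX₀A hq
  have hy := q.2
  -- On each branch of the light cone, `w₀ = ∓1` makes `(w - w₀) / y` constant, equal to `±1`, so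
  -- the calibration does not grow.
  rcases le_total 1 q.1.2 with h | h
  · rw [abs_of_nonneg (by linarith)] at hw
    have hd := lorentzDist_one_le hdet hA hX₀ hX₀A (q := q) (w₀ := -1) (by simp) (by
      rw [hw, sub_neg_eq_add, sub_add_cancel, abs_of_pos hy])
    rw [hw, sub_neg_eq_add, sub_add_cancel, div_self hy.ne', neg_neg, sub_self, zero_div,
      ENNReal.ofReal_zero] at hd
    exact le_zero_iff.1 hd
  · rw [abs_of_nonpos (by linarith)] at hw
    have e : -(q.1.2 - 1) - 1 = -q.1.2 := by ring
    have hd := lorentzDist_one_le hdet hA hX₀ hX₀A (q := q) (w₀ := 1) (by simp) (by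
      rw [hw, e, abs_neg, abs_of_pos hy])
    rw [hw, e, neg_div, div_self hy.ne', sub_self, zero_div, ENNReal.ofReal_zero] at hd
    exact le_zero_iff.1 hd

/-- The hypotheses are the strict triangle inequalities for lengths `1`, `y`, `w`; each bound clears
denominators to a difference of squares, such as `(y + w)² > 1` or `y² > (w - 1)²`. -/
theorem sin_arguments_mem_Ioo {w y : ℝ} (hy : 0 < y) (h1 : |y - 1| < w) (h2 : w < y + 1) :
    (y ^ 2 + w ^ 2 - 1) / (2 * y * w) ∈ Ioo (-1 : ℝ) 1 ∧
      (y ^ 2 - w ^ 2 - 1) / (2 * w) ∈ Ioo (-1 : ℝ) 1 := by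
  have hw : 0 < w := (abs_nonneg _).trans_lt h1
  rw [abs_lt] at h1
  refine ⟨⟨?_, ?_⟩, ?_, ?_⟩
  · rw [lt_div_iff₀ (by positivity)]; nlinarith
  · rw [div_lt_iff₀ (by positivity)]; nlinarith
  · rw [lt_div_iff₀ (by positivity)]; nlinarith
  · rw [div_lt_iff₀ (by positivity)]; nlinarith

theorem sub_center_div {w y : ℝ} (hw : w ≠ 0) :
    (w - -((y ^ 2 - w ^ 2 - 1) / (2 * w))) / y = (y ^ 2 + w ^ 2 - 1) / (2 * y * w) := by
  field_simp
  ring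

/-- With `w₀ = -sin ρ`, the hyperbola `Y² - (W - w₀)² = 1 - w₀²` through `(0, 1)` also passes
through `(w, y)`. -/
theorem sq_eq_of_center {w y : ℝ} (hw : w ≠ 0) :
    y ^ 2 = 1 - (-((y ^ 2 - w ^ 2 - 1) / (2 * w))) ^ 2 +
      (w - -((y ^ 2 - w ^ 2 - 1) / (2 * w))) ^ 2 := by
  field_simp
  ring

/-- Allowing `s` below the actual `w` serves the points of `F`, which are treated as the limit `s →
y + 1`. -/
theorem le_lorentzDist_of_le (hdet : 0 < A.det) (hA : |A 1 0| < A 0 0) {X₀ : ℝ × ℝ}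
    (hX₀ : lieForm A X₀ X₀ < 0) (hX₀A : 0 < v₁ A X₀) {q : AffPlus} {s : ℝ}
    (h1 : |q.1.2 - 1| < s) (h2 : s < q.1.2 + 1) (hs : s ≤ wCoord A q.1) :
    ENNReal.ofReal ((Real.arcsin ((q.1.2 ^ 2 + s ^ 2 - 1) / (2 * q.1.2 * s)) -
      Real.arcsin ((q.1.2 ^ 2 - s ^ 2 - 1) / (2 * s))) / Delta A) ≤ lorentzDist A X₀ 1 q := by
  have hs0 : 0 < s := (abs_nonneg _).trans_lt h1
  have h := geodesic_le_lorentzDist hdet hA hX₀ hX₀A (q := q) hs0.le hs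
    (w₀ := -((q.1.2 ^ 2 - s ^ 2 - 1) / (2 * s)))
    (by rw [abs_neg]; exact abs_lt.2 (sin_arguments_mem_Ioo q.2 h1 h2).2)
    (sq_eq_of_center hs0.ne')
  rwa [sub_center_div hs0.ne', neg_neg] at h

theorem lorentzDist_eq_of_mem_interior (hdet : 0 < A.det) (hA : |A 1 0| < A 0 0) {X₀ : ℝ × ℝ}
    (hX₀ : lieForm A X₀ X₀ < 0) (hX₀A : 0 < v₁ A X₀) {q : AffPlus}
    (hq : q ∈ interior (setD A)) :
    lorentzDist A X₀ 1 q = ENNReal.ofReal ((tau A q.1 - rho A q.1) / Delta A) := by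
  rw [mem_interior_setD_iff hdet hA] at hq
  obtain ⟨h1, h2⟩ := hq
  have hw : 0 < wCoord A q.1 := (abs_nonneg _).trans_lt h1
  obtain ⟨ht, hr⟩ := sin_arguments_mem_Ioo q.2 h1 h2
  refine le_antisymm ?_ (le_lorentzDist_of_le hdet hA hX₀ hX₀A h1 h2 le_rfl)
  have h := lorentzDist_one_le hdet hA hX₀ hX₀A (q := q)
    (w₀ := -((q.1.2 ^ 2 - wCoord A q.1 ^ 2 - 1) / (2 * wCoord A q.1)))
    (by rw [abs_neg]; exact (abs_lt.2 hr).le) (by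
      rw [← div_le_one₀ q.2, ← abs_of_pos q.2, ← abs_div, abs_of_pos q.2, sub_center_div hw.ne']
      exact (abs_lt.2 ht).le)
  rwa [sub_center_div hw.ne', neg_neg] at h

theorem lorentzDist_eq_of_mem_setF (hdet : 0 < A.det) (hA : |A 1 0| < A 0 0) {X₀ : ℝ × ℝ}
    (hX₀ : lieForm A X₀ X₀ < 0) (hX₀A : 0 < v₁ A X₀) {q : AffPlus} (hq : q ∈ setF A) :
    lorentzDist A X₀ 1 q = ENNReal.ofReal (Real.pi / Delta A) := by
  rw [mem_setF_iff hdet hA] at hq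
  have hy := q.2
  refine le_antisymm ?_ ?_
  · have h := lorentzDist_one_le hdet hA hX₀ hX₀A (q := q) (w₀ := 1) (by simp) (by
      rw [hq, add_sub_cancel_right, abs_of_pos hy])
    rwa [hq, add_sub_cancel_right, div_self hy.ne', Real.arcsin_neg, Real.arcsin_one,
      sub_neg_eq_add, add_halves] at h
  · set y := q.1.2 with hydef
    let G : ℝ → ENNReal := fun s => ENNReal.ofReal
      ((Real.arcsin ((y ^ 2 + s ^ 2 - 1) / (2 * y * s)) -
        Real.arcsin ((y ^ 2 - s ^ 2 - 1) / (2 * s))) / Delta A)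
    have hc : ContinuousAt G (y + 1) := by
      have e1 : ContinuousAt (fun s : ℝ => (y ^ 2 + s ^ 2 - 1) / (2 * y * s)) (y + 1) :=
        ContinuousAt.div (by fun_prop) (by fun_prop) (by positivity)
      have e2 : ContinuousAt (fun s : ℝ => (y ^ 2 - s ^ 2 - 1) / (2 * s)) (y + 1) :=
        ContinuousAt.div (by fun_prop) (by fun_prop) (by positivity)
      exact ENNReal.continuous_ofReal.continuousAt.comp
        (((Real.continuous_arcsin.continuousAt.comp e1).sub
          (Real.continuous_arcsin.continuousAt.comp e2)).div_const _)
    have hG : G (y + 1) = ENNReal.ofReal (Real.pi / Delta A) := by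
      have e1 : (y ^ 2 + (y + 1) ^ 2 - 1) / (2 * y * (y + 1)) = 1 := by
        rw [div_eq_one_iff_eq (by positivity)]; ring
      have e2 : (y ^ 2 - (y + 1) ^ 2 - 1) / (2 * (y + 1)) = -1 := by
        rw [div_eq_iff (by positivity)]; ring
      simp only [G]
      rw [e1, e2, Real.arcsin_neg, Real.arcsin_one, sub_neg_eq_add, add_halves]
    rw [← hG]
    refine le_of_tendsto (hc.tendsto.mono_left (nhdsWithin_le_nhds (s := Iio (y + 1)))) ?_
    have hlt : |y - 1| < y + 1 := abs_lt.2 ⟨by linarith, by linarith⟩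
    filter_upwards [Ioo_mem_nhdsLT hlt] with s hs
    exact le_lorentzDist_of_le hdet hA hX₀ hX₀A hs.1 hs.2 (by rw [hq]; exact hs.2.le)

theorem rho_lt_tau {q : AffPlus} (h1 : |q.1.2 - 1| < wCoord A q.1)
    (h2 : wCoord A q.1 < q.1.2 + 1) :
    rho A q.1 < tau A q.1 ∧ tau A q.1 - rho A q.1 < Real.pi := by
  have hw : 0 < wCoord A q.1 := (abs_nonneg _).trans_lt h1
  have hy := q.2
  obtain ⟨ht, hr⟩ := sin_arguments_mem_Ioo hy h1 h2
  constructor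
  · refine Real.strictMonoOn_arcsin (Ioo_subset_Icc_self hr) (Ioo_subset_Icc_self ht) ?_
    rw [sinTau, div_lt_div_iff₀ (by positivity) (by positivity)]
    have h3 : (q.1.2 - 1) ^ 2 < wCoord A q.1 ^ 2 := sq_lt_sq' (by linarith [(abs_lt.1 h1).1])
      (abs_lt.1 h1).2
    -- Half the difference of the cross-multiplied sides of the goal, in factored form.
    have h4 : 0 < (wCoord A q.1 ^ 2 - (q.1.2 - 1) ^ 2) * (q.1.2 + 1) * wCoord A q.1 :=
      mul_pos (mul_pos (by linarith) (by linarith)) hw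
    nlinarith
  · have a := Real.arcsin_lt_pi_div_two.2 ht.2
    have b := Real.neg_pi_div_two_lt_arcsin.2 hr.1
    simp only [tau, rho, sinTau, sinRho]
    linarith

theorem image_lorentzDist_interior (hdet : 0 < A.det) (hA : |A 1 0| < A 0 0) {X₀ : ℝ × ℝ}
    (hX₀ : lieForm A X₀ X₀ < 0) (hX₀A : 0 < v₁ A X₀) :
    lorentzDist A X₀ 1 '' interior (setD A) = Ioo 0 (ENNReal.ofReal (Real.pi / Delta A)) := by
  have hΔ := Delta_pos hdet hA
  ext v
  constructor
  · rintro ⟨q, hq, rfl⟩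
    rw [lorentzDist_eq_of_mem_interior hdet hA hX₀ hX₀A hq]
    rw [mem_interior_setD_iff hdet hA] at hq
    obtain ⟨h1, h2⟩ := rho_lt_tau hq.1 hq.2
    refine ⟨ENNReal.ofReal_pos.2 (div_pos (by linarith) hΔ), ?_⟩
    exact (ENNReal.ofReal_lt_ofReal_iff (div_pos Real.pi_pos hΔ)).2
      (div_lt_div_of_pos_right h2 hΔ)
  · rintro ⟨hv0, hv1⟩
    lift v to NNReal using (hv1.trans ENNReal.ofReal_lt_top).ne
    -- On the line `y = 1`, the point `w = 2 sin x` has `τ = x` and `ρ = -x`, hence distance `2x /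
    -- Δ`, which should equal `v`.
    set x : ℝ := v * Delta A / 2 with hx
    have hv : 0 < (v : ℝ) := by exact_mod_cast hv0
    have hx0 : 0 < x := by positivity
    have hxpi : x < Real.pi / 2 := by
      have : (v : ℝ) < Real.pi / Delta A := by
        rw [← ENNReal.ofReal_coe_nnreal] at hv1
        exact (ENNReal.ofReal_lt_ofReal_iff (div_pos Real.pi_pos hΔ)).1 hv1
      rw [lt_div_iff₀ hΔ] at this
      linarith
    have hs0 : 0 < Real.sin x := Real.sin_pos_of_pos_of_lt_pi hx0 (by linarith)
    have hs1 : Real.sin x < 1 := by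
      rw [← Real.sin_pi_div_two]
      exact Real.sin_lt_sin_of_lt_of_le_pi_div_two (by linarith) le_rfl hxpi
    have hwc := wCoord_add_mul hdet hA (2 * Real.sin x) 1
    have hmem : ofWY A (2 * Real.sin x) 1 one_pos ∈ interior (setD A) := by
      rw [mem_interior_setD_iff hdet hA]
      simp only [ofWY, hwc]
      rw [sub_self, abs_zero]
      constructor <;> linarith
    refine ⟨_, hmem, ?_⟩
    rw [lorentzDist_eq_of_mem_interior hdet hA hX₀ hX₀A hmem]
    have e1 : sinTau A (ofWY A (2 * Real.sin x) 1 one_pos).1 = Real.sin x := by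
      simp only [sinTau, ofWY, hwc]
      field_simp
      ring
    have e2 : sinRho A (ofWY A (2 * Real.sin x) 1 one_pos).1 = -Real.sin x := by
      simp only [sinRho, ofWY, hwc]
      field_simp
      ring
    rw [tau, rho, e1, e2, Real.arcsin_neg, Real.arcsin_sin (by linarith) hxpi.le,
      ← ENNReal.ofReal_coe_nnreal]
    congr 1
    rw [hx]
    field_simp
    ring

end AffPlus

theorem mainTheorem3 (A : Matrix (Fin 2) (Fin 2) ℝ) (hdet : 0 < A.det) (ha : 0 ≤ A 0 0)
    (X₀ : ℝ × ℝ) (hX₀ : AffPlus.lieForm A X₀ X₀ < 0) (hX₀A : 0 < AffPlus.v₁ A X₀)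
    (p : AffPlus) (hK : AffPlus.sectionalCurvature A p < 0) :
    (0 < AffPlus.Delta A ∧ AffPlus.lam A ≠ 0) ∧
    (∀ q₁ : AffPlus,
      (q₁ ∉ AffPlus.causalFuture A X₀ 1 → AffPlus.lorentzDist A X₀ 1 q₁ = 0) ∧
      (q₁ ∈ frontier (AffPlus.causalFuture A X₀ 1) → AffPlus.lorentzDist A X₀ 1 q₁ = 0) ∧
      (q₁ ∈ interior (AffPlus.setD A) →
        AffPlus.wCoord A q₁.1 ≠ 0 ∧
        AffPlus.sinTau A q₁.1 ∈ Set.Ioo (-1 : ℝ) 1 ∧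
        AffPlus.sinRho A q₁.1 ∈ Set.Ioo (-1 : ℝ) 1 ∧
        AffPlus.lorentzDist A X₀ 1 q₁ =
          ENNReal.ofReal ((AffPlus.tau A q₁.1 - AffPlus.rho A q₁.1) / AffPlus.Delta A)) ∧
      (q₁ ∈ AffPlus.setF A →
        AffPlus.lorentzDist A X₀ 1 q₁ = ENNReal.ofReal (Real.pi / AffPlus.Delta A)) ∧
      (q₁ ∈ AffPlus.setE A → AffPlus.lorentzDist A X₀ 1 q₁ = ⊤)) ∧
    AffPlus.lorentzDist A X₀ 1 '' interior (AffPlus.setD A) =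
      Set.Ioo 0 (ENNReal.ofReal (Real.pi / AffPlus.Delta A)) := by
  have hA := AffPlus.abs_entry_lt_of_sectionalCurvature_neg hdet ha hK
  refine ⟨⟨AffPlus.Delta_pos hdet hA, (AffPlus.lam_pos hdet hA).ne'⟩, fun q₁ =>
    ⟨AffPlus.lorentzDist_eq_zero_of_notMem X₀,
      AffPlus.lorentzDist_eq_zero_of_mem_frontier hdet hA hX₀ hX₀A, fun hq => ?_,
      AffPlus.lorentzDist_eq_of_mem_setF hdet hA hX₀ hX₀A, fun hq => ?_⟩,
    AffPlus.image_lorentzDist_interior hdet hA hX₀ hX₀A⟩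
  · have h := (AffPlus.mem_interior_setD_iff hdet hA q₁).1 hq
    obtain ⟨ht, hr⟩ := AffPlus.sin_arguments_mem_Ioo q₁.2 h.1 h.2
    exact ⟨((abs_nonneg _).trans_lt h.1).ne', ht, hr,
      AffPlus.lorentzDist_eq_of_mem_interior hdet hA hX₀ hX₀A hq⟩
  · exact AffPlus.lorentzDist_eq_top hdet hA hX₀ hX₀A ((AffPlus.mem_setE_iff hdet hA q₁).1 hq)
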